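/- Let $\mathbb K$ be a field of characteristic $0$, let $G$ be a finite group of order $n=|G|$, and let $r\ge 2$ and $L\ge 1$ be integers. Write $\mathbb K[G]$ for the group algebra, i.e. the space of functions (filters) $G\to\mathbb K$ with the convolution product $(\theta*\psi)(g)=\sum_{h\in G}\theta(gh^{-1})\psi(h)$. For a filter $\theta\in\mathbb K[G]$ let $\theta^{\otimes m}\in\mathbb K[G^m]$ be the filter $\theta^{\otimes m}(g_1,\dots,g_m)=\theta(g_1)\cdots\theta(g_m)$. For $0\le l\le L-1$ embed $G^{r^{L-1-l}}$ into $G^{r^{L-1}}$ by iterating the diagonal embedding $G\to G^r$ $l$ times (each coordinate is repeated $r^l$ times), and extend filters by zero along this embedding. The Kronecker parametrization of the depth-$L$ polynomial $G$-convolutional network with activation degree $r$ is the polynomial map $$\varphi:\mathbb K[G]^L\to\mathbb K[G^{r^{L-1}}],\qquad \varphi_\theta=\theta_1^{\otimes r^{L-1}}*\theta_2^{\otimes r^{L-2}}*\cdots*\theta_L .$$ It is homogeneous in each $\theta_l$ and hence induces a rational map $$\tilde\varphi:\mathbb P(\mathbb K[G])^L\dashrightarrow\mathbb P(\mathbb K[G^{r^{L-1}}]),\qquad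 ([\theta_1],\dots,[\theta_L])\mapsto[\varphi_\theta].$$ Let $\mathcal M_\varphi=\{\varphi_\theta : \theta\in\mathbb K[G]^L\}$ be the image of $\varphi$. Its dimension is the dimension of its Zariski closure, i.e. the Krull dimension of the polynomial ring in the coordinates of $\mathbb K[G^{r^{L-1}}]$ modulo the ideal of polynomials vanishing on $\mathcal M_\varphi$. A condition is said to hold at a general point if it holds at all points of some nonempty Zariski-open subset. **Theorem.** 1. At a general point $([\theta_1],\dots,[\theta_L])$ of $\mathbb P(\mathbb K[G])^L$ the map $\tilde\varphi$ is defined, and its Jacobian there, i.e. the linear map $\prod_{l}\mathbb K[G]/\mathbb K\theta_l\to\mathbb K[G^{r^{L-1}}]/\mathbb K\varphi_\theta$ of tangent spaces induced by the Jacobian $J_\theta\varphi$, has full rank; moreover it is injective. 2. $\dim\mathcal M_\varphi=L(n-1)+1$. In particular the dimension depends neither on $r$ nor on the group structure of $G$. 3. For general $\theta=(\theta_1,\dots,\theta_L)\in\mathbb K[G]^L$, the $L-1$ vectors $$(\theta_1,-r\theta_2,0,\dots,0),\ (0,\theta_2,-r\theta_3,0,\dots,0),\ \dots,\ (0,\dots,0,\theta_{L-1},-r\theta_L)$$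 form a basis of $\ker J_\theta\varphi$. -/

import Mathlib

open scoped LinearAlgebra.Projectivization

noncomputable section

namespace PGCNN

/-! ### The Kronecker parametrization

`S`-filters over `G` are the elements of the group algebra `MonoidAlgebra S G`, whose product is
the convolution `(θ * ψ)(g) = ∑ h, θ (g * h⁻¹) * ψ h`.  The direct power `G ^ m` is
`Fin m → G`. Layers are numbered `0, …, L - 1`. -/

/-- The Kronecker power `θ^{⊗ m} ∈ S[G ^ m]`, with `θ^{⊗ m} (g₁, …, gₘ) = θ g₁ ⋯ θ gₘ`. -/
def kronPow {S G : Type*} [CommRing S] [Finite G] (m : ℕ) (θ : MonoidAlgebra S G) :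
    MonoidAlgebra S (Fin m → G) :=
  MonoidAlgebra.ofCoeff
    (Finsupp.equivFunOnFinite.symm fun g : Fin m → G => ∏ i, θ.coeff (g i))

theorem div_pow_lt {r L : ℕ} (l : Fin L) (j : Fin (r ^ (L - 1))) :
    (j : ℕ) / r ^ (l : ℕ) < r ^ (L - 1 - (l : ℕ)) := by
  apply Nat.div_lt_of_lt_mul
  rw [← pow_add, Nat.add_sub_cancel' (by have := l.isLt; omega)]
  exact j.isLt

/-- The diagonal inclusion `G ^ (r ^ (L - 1 - l)) → G ^ (r ^ (L - 1))` obtained by iterating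
`l` times the diagonal inclusion `G → G ^ r`: every coordinate is repeated `r ^ l` times. -/
def diagHom (G : Type*) [Group G] (r : ℕ) {L : ℕ} (l : Fin L) :
    (Fin (r ^ (L - 1 - (l : ℕ))) → G) →* (Fin (r ^ (L - 1)) → G) where
  toFun g := fun j => g ⟨(j : ℕ) / r ^ (l : ℕ), div_pow_lt l j⟩
  map_one' := rfl
  map_mul' _ _ := rfl

/-- The factor of `φ_θ` that comes from the layer `l`: the filter `θ_l^{⊗ r ^ (L - 1 - l)}`,
extended by zero from the diagonal subgroup to a filter over `G ^ (r ^ (L - 1))`. -/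
def layerFactor {S G : Type*} [CommRing S] [Group G] [Finite G] (r : ℕ) {L : ℕ}
    (θ : Fin L → MonoidAlgebra S G) (l : Fin L) : MonoidAlgebra S (Fin (r ^ (L - 1)) → G) :=
  MonoidAlgebra.mapDomainRingHom S (diagHom G r l) (kronPow (r ^ (L - 1 - (l : ℕ))) (θ l))

/-- The Kronecker parametrization
`φ_θ = θ₁^{⊗ r ^ (L - 1)} * θ₂^{⊗ r ^ (L - 2)} * ⋯ * θ_L ∈ S[G ^ (r ^ (L - 1))]`
(a convolution product, in this order). -/
def kronParam {S G : Type*} [CommRing S] [Group G] [Finite G] (r : ℕ) {L : ℕ}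
    (θ : Fin L → MonoidAlgebra S G) : MonoidAlgebra S (Fin (r ^ (L - 1)) → G) :=
  (List.ofFn (layerFactor r θ)).prod

/-- The image `M_φ` of the parametrization map `φ : K[G] ^ L → K[G ^ (r ^ (L - 1))]`. -/
def kronImage (K G : Type*) [Field K] [Group G] [Finite G] (r L : ℕ) :
    Set (MonoidAlgebra K (Fin (r ^ (L - 1)) → G)) :=
  Set.range fun θ : Fin L → MonoidAlgebra K G => kronParam r θ

/-! ### The Jacobian -/

/-- The coordinates of a tuple of filters. -/
def coords {K G : Type*} [Field K] {L : ℕ} (θ : Fin L → MonoidAlgebra K G) : Fin L × G → K :=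
  fun x => (θ x.1).coeff x.2

/-- The tuple of filters whose coordinates are the indeterminates `X (l, g)`. -/
def genericFilters (K G : Type*) [Field K] [Finite G] (L : ℕ) :
    Fin L → MonoidAlgebra (MvPolynomial (Fin L × G) K) G :=
  fun l => MonoidAlgebra.ofCoeff
    (Finsupp.equivFunOnFinite.symm fun g : G => MvPolynomial.X (l, g))

/-- The coordinate of index `k` of the map `φ`, as a polynomial in the coordinates of the
filters. -/
def kronPoly (K G : Type*) [Field K] [Group G] [Finite G] (r L : ℕ)
    (k : Fin (r ^ (L - 1)) → G) : MvPolynomial (Fin L × G) K :=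
  (kronParam r (genericFilters K G L)).coeff k

/-- The Jacobian `J_θ φ : K[G] ^ L → K[G ^ (r ^ (L - 1))]` of `φ` at `θ`, that is, the linear map
whose matrix consists of the partial derivatives of the polynomials `kronPoly` at `θ`. -/
def jacobian {K G : Type*} [Field K] [Group G] [Fintype G] (r : ℕ) {L : ℕ}
    (θ : Fin L → MonoidAlgebra K G) :
    (Fin L → MonoidAlgebra K G) →ₗ[K] MonoidAlgebra K (Fin (r ^ (L - 1)) → G) where
  toFun v := MonoidAlgebra.ofCoeff (Finsupp.equivFunOnFinite.symm fun k =>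
    ∑ x : Fin L × G,
      MvPolynomial.eval (coords θ) (MvPolynomial.pderiv x (kronPoly K G r L k)) * coords v x)
  map_add' v w := by
    ext k
    simp [coords, mul_add, Finset.sum_add_distrib]
  map_smul' c v := by
    ext k
    simp [coords, Finset.mul_sum, mul_left_comm]

/-- The direction in the parameter space given by infinitesimal rescaling of the layers `i` and
`i + 1`, namely `(0, …, 0, θ_i, -r θ_{i+1}, 0, …, 0)`. -/
def rescalingDir {K G : Type*} [Field K] (r : ℕ) {L : ℕ}
    (θ : Fin L → MonoidAlgebra K G) (i : Fin (L - 1)) : Fin L → MonoidAlgebra K G :=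
  fun l =>
    if (l : ℕ) = i then θ l
    else if (l : ℕ) = i + 1 then -((r : K) • θ l)
    else 0

/-! ### Auxiliary facts: homogeneity and Euler's relation

They show that the rational map between projective spaces induced by `φ`, and its differential,
are well defined. -/

theorem layerFactor_smul {S G : Type*} [CommRing S] [Group G] [Finite G] (r : ℕ) {L : ℕ}
    (θ : Fin L → MonoidAlgebra S G) (c : Fin L → S) (l : Fin L) :
    layerFactor r (fun l => c l • θ l) l = c l ^ r ^ (L - 1 - (l : ℕ)) • layerFactor r θ l := by
  have h : kronPow (r ^ (L - 1 - (l : ℕ))) (c l • θ l)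
      = c l ^ r ^ (L - 1 - (l : ℕ)) • kronPow (r ^ (L - 1 - (l : ℕ))) (θ l) := by
    ext g
    simp [kronPow, Finset.prod_mul_distrib]
  unfold layerFactor
  rw [h]
  ext g
  simp [MonoidAlgebra.mapDomainRingHom, MonoidAlgebra.mapDomain, Finsupp.mapDomain_smul]

theorem prod_ofFn_smul {S A : Type*} [CommRing S] [Ring A] [Algebra S A] :
    ∀ {L : ℕ} (c : Fin L → S) (x : Fin L → A),
      (List.ofFn fun l => c l • x l).prod = (∏ l, c l) • (List.ofFn x).prod
  | 0, c, x => by simp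
  | L + 1, c, x => by
    rw [List.ofFn_succ, List.prod_cons, prod_ofFn_smul, List.ofFn_succ, List.prod_cons,
      Fin.prod_univ_succ, smul_mul_smul_comm]

/-- `φ` is multihomogeneous of multidegree `(r ^ (L - 1), r ^ (L - 2), …, 1)`. -/
theorem kronParam_smul {S G : Type*} [CommRing S] [Group G] [Finite G] (r : ℕ) {L : ℕ}
    (θ : Fin L → MonoidAlgebra S G) (c : Fin L → S) :
    kronParam r (fun l => c l • θ l) = (∏ l, c l ^ r ^ (L - 1 - (l : ℕ))) • kronParam r θ := by
  unfold kronParam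
  rw [← prod_ofFn_smul]
  congr 2
  funext l
  exact layerFactor_smul r θ c l

theorem map_kronParam {S T G : Type*} [CommRing S] [CommRing T] [Group G] [Finite G] (f : S →+* T)
    (r : ℕ) {L : ℕ} (θ : Fin L → MonoidAlgebra S G) :
    MonoidAlgebra.mapRingHom _ f (kronParam r θ)
      = kronParam r (fun l => MonoidAlgebra.mapRingHom _ f (θ l)) := by
  unfold kronParam
  rw [map_list_prod, List.map_ofFn]
  congr 2
  funext l
  have h : ∀ m : ℕ, MonoidAlgebra.mapRingHom _ f (kronPow m (θ l))
      = kronPow m (MonoidAlgebra.mapRingHom _ f (θ l)) := by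
    intro m
    ext g
    simp [kronPow]
  have h2 := congrArg (fun F => F (kronPow (r ^ (L - 1 - (l : ℕ))) (θ l)))
    (MonoidAlgebra.mapRingHom_comp_mapDomainRingHom f (diagHom G r l))
  simp only [RingHom.comp_apply] at h2
  simp only [Function.comp_apply, layerFactor]
  rw [h2, h]

/-- The polynomials `kronPoly` are the coordinates of `φ`. -/
theorem eval_kronPoly {K G : Type*} [Field K] [Group G] [Finite G] (r : ℕ) {L : ℕ}
    (θ : Fin L → MonoidAlgebra K G) (k : Fin (r ^ (L - 1)) → G) :
    MvPolynomial.eval (coords θ) (kronPoly K G r L k) = (kronParam r θ).coeff k := by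
  have h := map_kronParam (MvPolynomial.eval (coords θ)) r (genericFilters K G L)
  have h2 : (fun l => MonoidAlgebra.mapRingHom _ (MvPolynomial.eval (coords θ))
      (genericFilters K G L l)) = θ := by
    funext l
    ext g
    simp [genericFilters, coords]
  rw [h2] at h
  rw [← h, MonoidAlgebra.coeff_mapRingHom]
  rfl

/-- The coefficients of `kronParam` at the generic filters are homogeneous, of one common degree,
in the coordinates of each layer. -/
theorem kronPoly_isWeightedHomogeneous (K G : Type*) [Field K] [Group G] [Finite G] (r L : ℕ)
    (i : Fin L) :
    ∃ d : ℕ, ∀ k : Fin (r ^ (L - 1)) → G,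
      (kronPoly K G r L k).IsWeightedHomogeneous
        (fun x : Fin L × G => if x.1 = i then 1 else 0) d := by
  classical
  set w : Fin L × G → ℕ := fun x => if x.1 = i then 1 else 0 with hw
  have key : ∀ s : List (MonoidAlgebra (MvPolynomial (Fin L × G) K) (Fin (r ^ (L - 1)) → G)),
      (∀ a ∈ s, ∃ d : ℕ, ∀ k, (a.coeff k).IsWeightedHomogeneous w d) →
      ∃ d : ℕ, ∀ k, (s.prod.coeff k).IsWeightedHomogeneous w d := by
    intro s
    induction s with
    | nil =>
      intro _
      refine ⟨0, fun k => ?_⟩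
      rw [List.prod_nil, MonoidAlgebra.one_def, MonoidAlgebra.coeff_single, Finsupp.single_apply]
      split_ifs
      · exact MvPolynomial.isWeightedHomogeneous_one K w
      · exact MvPolynomial.isWeightedHomogeneous_zero K w 0
    | cons a s ih =>
      intro h
      obtain ⟨d, hd⟩ := h a (by simp)
      obtain ⟨e, he⟩ := ih fun b hb => h b (by simp [hb])
      refine ⟨d + e, fun k => ?_⟩
      rw [List.prod_cons, MonoidAlgebra.coeff_mul]
      refine MvPolynomial.IsWeightedHomogeneous.sum _ _ _ fun x _ => ?_
      refine MvPolynomial.IsWeightedHomogeneous.sum _ _ _ fun y _ => ?_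
      beta_reduce
      split_ifs
      · exact (hd x).mul (he y)
      · exact MvPolynomial.isWeightedHomogeneous_zero K w _
  refine key _ fun a ha => ?_
  obtain ⟨l, rfl⟩ := (List.mem_ofFn' _ _).1 ha
  have hx : ∀ x : Fin (r ^ (L - 1 - (l : ℕ))) → G,
      ((kronPow _ (genericFilters K G L l)).coeff x).IsWeightedHomogeneous w
        (∑ j : Fin (r ^ (L - 1 - (l : ℕ))), w (l, x j)) := fun x =>
    MvPolynomial.IsWeightedHomogeneous.prod _ _ _ fun j _ =>
      MvPolynomial.isWeightedHomogeneous_X K w (l, x j)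
  refine ⟨∑ _j : Fin (r ^ (L - 1 - (l : ℕ))), (if l = i then 1 else 0), fun k => ?_⟩
  change MvPolynomial.IsWeightedHomogeneous w
    ((Finsupp.mapDomain (diagHom G r l) (kronPow _ (genericFilters K G L l)).coeff) k) _
  rw [Finsupp.mapDomain, Finsupp.sum, Finsupp.finsetSum_apply]
  refine MvPolynomial.IsWeightedHomogeneous.sum _ _ _ fun x _ => ?_
  rw [Finsupp.single_apply]
  by_cases h : diagHom G r l x = k
  · rw [if_pos h]
    exact hx x
  · rw [if_neg h]
    exact MvPolynomial.isWeightedHomogeneous_zero K w _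

/-- Euler's relation: the Jacobian of `φ` at `θ` maps a tuple whose entries are multiples of
the `θ_l` to a multiple of `φ_θ`. -/
theorem jacobian_euler {K G : Type*} [Field K] [Group G] [Fintype G] (r : ℕ) {L : ℕ}
    (θ : Fin L → MonoidAlgebra K G) :
    Submodule.pi Set.univ (fun l => Submodule.span K {θ l}) ≤
      (Submodule.span K {kronParam r θ}).comap (jacobian r θ) := by
  intro v hv
  have hv' : ∀ l, ∃ c : K, c • θ l = v l := fun l =>
    Submodule.mem_span_singleton.1 (hv l (Set.mem_univ l))
  choose c hc using hv'
  choose d hd using kronPoly_isWeightedHomogeneous K G r L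
  rw [Submodule.mem_comap, Submodule.mem_span_singleton]
  refine ⟨∑ l, c l * d l, ?_⟩
  ext k
  have eul : ∀ i : Fin L, ∑ g : G, (θ i).coeff g *
      MvPolynomial.eval (coords θ) (MvPolynomial.pderiv (i, g) (kronPoly K G r L k))
      = d i * (kronParam r θ).coeff k := by
    intro i
    have h := congrArg (MvPolynomial.eval (coords θ)) (hd i k).sum_weight_X_mul_pderiv
    rw [map_sum, Fintype.sum_prod_type, Finset.sum_eq_single i] at h
    · simpa [coords, eval_kronPoly] using h
    · intro j _ hj
      simp [hj]
    · simp
  simp only [jacobian, LinearMap.coe_mk, AddHom.coe_mk, MonoidAlgebra.coeff_smul_apply,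
    Finsupp.equivFunOnFinite_symm_apply_apply, smul_eq_mul]
  rw [Fintype.sum_prod_type, Finset.sum_mul]
  refine Finset.sum_congr rfl fun l _ => ?_
  rw [mul_assoc, ← eul l, Finset.mul_sum]
  refine Finset.sum_congr rfl fun g _ => ?_
  simp [coords, ← hc l]
  ring

/-! ### The projectivized parametrization and its differential -/

/-- The rational map `φ̃ : ℙ(K[G]) ^ L ⇢ ℙ(K[G ^ (r ^ (L - 1))])` induced by `φ`, as a partial
function: it is defined at `([θ₁], …, [θ_L])` if `φ_θ ≠ 0`, and its value there is `[φ_θ]`. -/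
def kronProj {K G : Type*} [Field K] [Group G] [Finite G] (r : ℕ) {L : ℕ} :
    (Fin L → ℙ K (MonoidAlgebra K G)) →. ℙ K (MonoidAlgebra K (Fin (r ^ (L - 1)) → G)) :=
  fun p => ⟨kronParam r (fun l => (p l).rep) ≠ 0, fun h => Projectivization.mk K _ h⟩

/-- The value of `φ̃` does not depend on the chosen representatives. -/
theorem mem_kronProj_mk {K G : Type*} [Field K] [Group G] [Finite G] (r : ℕ) {L : ℕ}
    (θ : Fin L → MonoidAlgebra K G) (hθ : ∀ l, θ l ≠ 0) (h : kronParam r θ ≠ 0) :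
    Projectivization.mk K (kronParam r θ) h
      ∈ kronProj r (fun l => Projectivization.mk K (θ l) (hθ l)) := by
  choose a ha using fun l => Projectivization.exists_smul_eq_mk_rep K (θ l) (hθ l)
  have e : kronParam r (fun l => (Projectivization.mk K (θ l) (hθ l)).rep)
      = (∏ l, (a l : K) ^ r ^ (L - 1 - (l : ℕ))) • kronParam r θ := by
    rw [← kronParam_smul]
    congr 1
    funext l
    exact (ha l).symm
  have hne : (∏ l, (a l : K) ^ r ^ (L - 1 - (l : ℕ))) ≠ 0 :=
    Finset.prod_ne_zero_iff.2 fun l _ => pow_ne_zero _ (a l).ne_zero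
  refine ⟨?_, ?_⟩
  · change kronParam r (fun l => (Projectivization.mk K (θ l) (hθ l)).rep) ≠ 0
    rw [e]
    exact smul_ne_zero hne h
  · refine (Projectivization.mk_eq_mk_iff' K _ _ _ _).2 ⟨_, e.symm⟩

/-- The differential of `φ̃` at `([θ₁], …, [θ_L])`. A representative `v` of a point `[v]` of `ℙ(V)`
identifies the tangent space of `ℙ(V)` at `[v]` with `V ⧸ K v`; under these identifications
the differential is the map `∏ l, K[G] ⧸ K θ_l → K[G ^ (r ^ (L - 1))] ⧸ K φ_θ` induced by
`J_θ φ`. -/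
def projDifferential {K G : Type*} [Field K] [Group G] [Fintype G] (r : ℕ) {L : ℕ}
    (θ : Fin L → MonoidAlgebra K G) :
    (∀ l, MonoidAlgebra K G ⧸ Submodule.span K {θ l}) →ₗ[K]
      (MonoidAlgebra K (Fin (r ^ (L - 1)) → G) ⧸ Submodule.span K {kronParam r θ}) :=
  (Submodule.mapQ _ _ (jacobian r θ) (jacobian_euler r θ)).comp
    (Submodule.quotientPi fun l => Submodule.span K {θ l}).symm.toLinearMap

/-- A linear map between finite-dimensional spaces has full rank if its rank is the smaller one
of the two dimensions. -/
def HasFullRank {K V W : Type*} [Field K] [AddCommGroup V] [Module K V] [AddCommGroup W]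
    [Module K W] (f : V →ₗ[K] W) : Prop :=
  Module.finrank K (LinearMap.range f) = min (Module.finrank K V) (Module.finrank K W)

/-! ### Generality and dimension -/

/-- A condition on `L`-tuples of filters is general if it holds on a nonempty Zariski-open subset
of `K[G] ^ L`. -/
def IsGeneral {K G : Type*} [Field K] {L : ℕ} (P : (Fin L → MonoidAlgebra K G) → Prop) : Prop :=
  ∃ F : MvPolynomial (Fin L × G) K, F ≠ 0 ∧
    ∀ θ : Fin L → MonoidAlgebra K G, MvPolynomial.eval (coords θ) F ≠ 0 → P θ

/-- A condition on the points of `ℙ(K[G]) ^ L` is general if it holds on a nonempty Zariski-open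
subset, here the complement of the zero locus of a nonzero polynomial `F` that is homogeneous
of degree `d l` in the coordinates of the factor of index `l`, for each `l`. -/
def IsGeneralProj {K G : Type*} [Field K] {L : ℕ}
    (P : (Fin L → ℙ K (MonoidAlgebra K G)) → Prop) : Prop :=
  ∃ (F : MvPolynomial (Fin L × G) K) (d : Fin L → ℕ), F ≠ 0 ∧
    F.IsWeightedHomogeneous (fun x : Fin L × G => (Pi.single x.1 1 : Fin L → ℕ)) d ∧
    ∀ p : Fin L → ℙ K (MonoidAlgebra K G),
      MvPolynomial.eval (coords fun l => (p l).rep) F ≠ 0 → P p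

/-- The dimension of a subset `M` of the affine space `K[H]` (with `H` finite): the Krull
dimension of the coordinate ring of the Zariski closure of `M`, i.e. of the polynomial ring in
the coordinates modulo the ideal of the polynomials that vanish on `M`. -/
def zariskiDim {K H : Type*} [Field K] (M : Set (MonoidAlgebra K H)) : WithBot ℕ∞ :=
  ringKrullDim (MvPolynomial H K ⧸
    MvPolynomial.vanishingIdeal K ((fun ψ : MonoidAlgebra K H => (ψ.coeff : H → K)) '' M))

end PGCNN

end

noncomputable section

namespace PGCNN

/-! ### Krull dimension and algebraic independence -/

/-! Let `n` be the order of `G` and `N = L(n-1)+1`. Rescaling the layers by constants `c l` with `∏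
c l ^ r^(L-1-l) = 1` does not change `φ_θ`, so `L-1` parameters are redundant. Infinitesimally this
is Euler's relation (`jacobian_smul_self`), which puts the rescaling directions into the kernel of
the Jacobian.

Nothing else is lost generically, and a single point shows it. When every filter is the identity,
the derivative of `φ` along the coordinate `(l, g)` is the sum, over the blocks of length `r^l`, of
the delta functions at the tuples equal to `g` on that block and `1` elsewhere. As `r ≥ 2`, blocks
of different layers have different lengths, so for `g ≠ 1` these sums have disjoint supports that
avoid the identity tuple. Together with the coordinate `(last, 1)` they give an `N × N` minor equal
to the identity matrix (`eval_minorMatrix_one`). Its determinant is thus a nonzero polynomial, and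
where it does not vanish the kernel has dimension at most `Ln - N = L-1`. This yields the kernel and
the injectivity of the projective differential.

For the dimension, the minor and the Jacobian criterion give `N` algebraically independent
coordinates. Conversely, normalizing `L-1` coefficients to `1` keeps the ideal of relations
(`ker_aeval_normalization`), so the coordinate ring embeds into a polynomial ring in `N` variables.
-/

/-- Krull dimension is invariant under injective integral extensions. -/
theorem ringKrullDim_eq_of_isIntegral (R S : Type*) [CommRing R] [CommRing S] [Algebra R S]
    [Algebra.IsIntegral R S] [FaithfulSMul R S] : ringKrullDim S = ringKrullDim R := by
  apply le_antisymm
  · refine Order.krullDim_le_of_strictMono (PrimeSpectrum.comap (algebraMap R S)) ?_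
    intro p q h
    exact Ideal.IsIntegral.comap_lt_comap (R := R) (I := p.asIdeal) (J := q.asIdeal) h
  · refine iSup_le fun l => ?_
    obtain ⟨Q, hQ, hQl⟩ := Ideal.exists_ideal_over_prime_of_isIntegral (S := S) l.head.asIdeal ⊥
      (by
        rw [Ideal.comap_bot_of_injective _ (FaithfulSMul.algebraMap_injective R S)]
        exact bot_le)
    have : Q.IsPrime := hQl.1
    have : Q.LiesOver l.head.asIdeal := ⟨hQl.2.symm⟩
    obtain ⟨l', hl', -⟩ := Ideal.exists_ltSeries_of_hasGoingUp (S := S) l Q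
    rw [← hl']
    exact le_iSup (fun p : LTSeries (PrimeSpectrum S) => ((p.length : ℕ∞) : WithBot ℕ∞)) l'

/-- The Krull dimension of a finitely generated domain over a field is its transcendence degree. -/
theorem ringKrullDim_eq_of_trdeg_eq (K A : Type*) [Field K] [CommRing A] [IsDomain A] [Algebra K A]
    [Algebra.FiniteType K A] {N : ℕ} (h : Algebra.trdeg K A = N) : ringKrullDim A = N := by
  -- Noether normalization; additivity of the transcendence degree then forces `s = N`.
  obtain ⟨s, g, hg, hint⟩ := exists_integral_inj_algHom_of_fg K A
  algebraize [g.toRingHom]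
  have : FaithfulSMul (MvPolynomial (Fin s) K) A := (faithfulSMul_iff_algebraMap_injective _ _).2 hg
  have : Algebra.IsIntegral (MvPolynomial (Fin s) K) A := ⟨hint⟩
  have : IsScalarTower K (MvPolynomial (Fin s) K) A := .of_algebraMap_eq' g.comp_algebraMap.symm
  have hs := lift_trdeg_add_eq K (MvPolynomial (Fin s) K) A
  rw [MvPolynomial.trdeg_of_isDomain, trdeg_eq_zero (R := MvPolynomial (Fin s) K) (A := A), h] at hs
  have hs' : s = N := by simpa using hs
  rw [ringKrullDim_eq_of_isIntegral (MvPolynomial (Fin s) K) A,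
    MvPolynomial.ringKrullDim_of_isNoetherianRing]
  simp [hs']

/-- The chain rule for a derivation applied to a polynomial expression. -/
theorem derivation_aeval {K A M ι : Type*} [CommRing K] [CommRing A] [Algebra K A] [Fintype ι]
    [AddCommGroup M] [Module A M] [Module K M] [IsScalarTower K A M]
    (D : Derivation K A M) (f : ι → A) (P : MvPolynomial ι K) :
    D (MvPolynomial.aeval f P) = ∑ t, MvPolynomial.aeval f (MvPolynomial.pderiv t P) • D (f t) := by
  classical
  induction P using MvPolynomial.induction_on with
  | C a => simp
  | add p q hp hq => simp [hp, hq, add_smul, Finset.sum_add_distrib]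
  | mul_X p i hp =>
    simp only [map_mul, MvPolynomial.aeval_X, Derivation.leibniz, hp, MvPolynomial.pderiv_X,
      smul_eq_mul, map_add, add_smul, Finset.sum_add_distrib]
    congr 1
    · rw [Finset.sum_eq_single i]
      · simp
      · intro b _ hb
        simp [hb.symm]
      · simp
    · simp [Finset.smul_sum, mul_smul]

/-- A coefficient at `m` with `m t ≠ 0` reappears in the derivative along `t` multiplied by `m t`,
which is invertible in characteristic zero. -/
theorem eq_C_of_pderiv_eq_zero {K ι : Type*} [Field K] [CharZero K] (P : MvPolynomial ι K)
    (h : ∀ t, MvPolynomial.pderiv t P = 0) : P = MvPolynomial.C (MvPolynomial.coeff 0 P) := by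
  classical
  ext m
  by_cases hm : m = 0
  · simp [hm]
  · rw [MvPolynomial.coeff_C, if_neg (Ne.symm hm)]
    obtain ⟨t, ht⟩ := Finsupp.ne_iff.1 hm
    have h1 := congrArg (MvPolynomial.coeff (m - Finsupp.single t 1)) (h t)
    have h2 : m - Finsupp.single t 1 + Finsupp.single t 1 = m := by
      apply tsub_add_cancel_of_le
      rw [Finsupp.single_le_iff]
      exact Nat.one_le_iff_ne_zero.2 ht
    rw [MvPolynomial.coeff_pderiv, h2, MvPolynomial.coeff_zero] at h1
    refine (mul_eq_zero.1 h1).resolve_right ?_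
    exact Nat.cast_add_one_ne_zero _

theorem totalDegree_pderiv_le {K ι : Type*} [Field K] {P : MvPolynomial ι K} (t : ι) {d : ℕ}
    (h : P.totalDegree ≤ d + 1) : (MvPolynomial.pderiv t P).totalDegree ≤ d := by
  refine Finset.sup_le fun m hm => ?_
  rw [MvPolynomial.mem_support_iff, MvPolynomial.coeff_pderiv] at hm
  have h1 := MvPolynomial.le_totalDegree (MvPolynomial.mem_support_iff.2 (left_ne_zero_of_mul hm))
  rw [Finsupp.sum_add_index' (by simp) (by simp), Finsupp.sum_single_index rfl] at h1
  omega

/-- The Jacobian criterion for algebraic independence in characteristic zero. -/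
theorem algebraicIndependent_of_jacobian_minor_ne_zero {K σ ι : Type*} [Field K] [CharZero K]
    [Fintype ι] [DecidableEq ι] (f : ι → MvPolynomial σ K) (c : ι → σ)
    (h : (Matrix.of fun t s => MvPolynomial.pderiv (c s) (f t)).det ≠ 0) :
    AlgebraicIndependent K f := by
  rw [algebraicIndependent_iff]
  suffices ∀ (d : ℕ) (P : MvPolynomial ι K), P.totalDegree ≤ d →
      MvPolynomial.aeval f P = 0 → P = 0 from fun P hP => this _ P le_rfl hP
  intro d
  induction d with
  | zero =>
    intro P hd hP
    obtain ⟨a, rfl⟩ : ∃ a, P = MvPolynomial.C a :=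
      ⟨_, MvPolynomial.totalDegree_eq_zero_iff_eq_C.1 (Nat.le_zero.1 hd)⟩
    simpa using hP
  | succ d ih =>
    intro P hd hP
    -- Differentiating the relation `P(f) = 0` along the variables `c s` gives a vector killed by
    -- the invertible minor. So each partial derivative of `P` is a relation of smaller degree,
    -- hence zero by induction, and `P` is constant.
    have h0 : (fun t => MvPolynomial.aeval f (MvPolynomial.pderiv t P)) = 0 := by
      refine Matrix.eq_zero_of_vecMul_eq_zero h ?_
      funext s
      have := derivation_aeval (MvPolynomial.pderiv (R := K) (c s)) f P
      rw [hP, map_zero] at this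
      simpa [Matrix.vecMul, dotProduct] using this.symm
    have h1 : ∀ t, MvPolynomial.pderiv t P = 0 := by
      intro t
      by_contra hne
      exact hne (ih _ (totalDegree_pderiv_le t hd) (congrFun h0 t))
    rw [eq_C_of_pderiv_eq_zero P h1] at hP ⊢
    simpa using hP

/-- If `I` is the ideal of relations of polynomials `f` with a nonzero Jacobian minor of size `#ι`,
and also the ideal of relations of some polynomials in `#ι` variables, then the coordinate ring
modulo `I` has dimension `#ι`. -/
theorem ringKrullDim_quotient_eq_card {K H σ ι : Type*} [Field K] [CharZero K] [Finite H]
    [Fintype ι] [DecidableEq ι] (f : H → MvPolynomial σ K) (R : ι → H) (c : ι → σ)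
    (h : (Matrix.of fun t s => MvPolynomial.pderiv (c s) (f (R t))).det ≠ 0)
    (f' : H → MvPolynomial ι K) (I : Ideal (MvPolynomial H K))
    (hf : I = RingHom.ker (MvPolynomial.aeval (R := K) f))
    (hf' : I = RingHom.ker (MvPolynomial.aeval (R := K) f')) :
    ringKrullDim (MvPolynomial H K ⧸ I) = Fintype.card ι := by
  have hprime : I.IsPrime := hf ▸ RingHom.ker_isPrime _
  let e := Ideal.Quotient.liftₐ I (MvPolynomial.aeval (R := K) f) fun a ha => by
    simpa [hf] using ha
  let e' := Ideal.Quotient.liftₐ I (MvPolynomial.aeval (R := K) f') fun a ha => by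
    simpa [hf'] using ha
  have he' : Function.Injective e' := by
    rw [injective_iff_map_eq_zero]
    intro a ha
    obtain ⟨a, rfl⟩ := Ideal.Quotient.mk_surjective a
    rw [Ideal.Quotient.eq_zero_iff_mem, hf']
    exact ha
  have hind : AlgebraicIndependent K
      (fun t => Ideal.Quotient.mk I (MvPolynomial.X (R t) : MvPolynomial H K)) := by
    refine AlgebraicIndependent.of_comp e ?_
    have := algebraicIndependent_of_jacobian_minor_ne_zero (fun t => f (R t)) c h
    convert this using 1
    funext t
    exact MvPolynomial.aeval_X (R := K) f (R t)
  refine ringKrullDim_eq_of_trdeg_eq K _ ?_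
  -- The independent coordinates bound the transcendence degree from below, the embedding `e'` from
  -- above.
  have h1 := hind.lift_cardinalMk_le_trdeg
  have h2 := lift_trdeg_le_of_injective e' he'
  rw [MvPolynomial.trdeg_of_isDomain] at h2
  simp at h1 h2
  exact le_antisymm (by simpa using h2) (by simpa using h1)

/-! ### Multihomogeneity and Euler's relation -/

/-- Weights add under convolution. They lie in an arbitrary monoid because two gradings are needed:
`ℕ`, singling out one layer, for Euler's relation, and `Fin L → ℕ` for the multidegree on the
product of projective spaces. -/
theorem isWeightedHomogeneous_list_prod_coeff {K σ M H : Type*} [Field K] [AddCommMonoid M]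
    [Group H] (w : σ → M) :
    ∀ {L : ℕ} (x : Fin L → MonoidAlgebra (MvPolynomial σ K) H) (d : Fin L → M),
      (∀ l k, ((x l).coeff k).IsWeightedHomogeneous w (d l)) →
      ∀ k, ((List.ofFn x).prod.coeff k).IsWeightedHomogeneous w (∑ l, d l)
  | 0, x, d, _, k => by
    classical
    rw [List.ofFn_zero, List.prod_nil, MonoidAlgebra.one_def, MonoidAlgebra.coeff_single,
      Finsupp.single_apply, Fin.sum_univ_zero]
    split_ifs
    · exact MvPolynomial.isWeightedHomogeneous_one K w
    · exact MvPolynomial.isWeightedHomogeneous_zero K w 0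
  | L + 1, x, d, h, k => by
    classical
    rw [List.ofFn_succ, List.prod_cons, MonoidAlgebra.coeff_mul, Fin.sum_univ_succ]
    refine MvPolynomial.IsWeightedHomogeneous.sum _ _ _ fun a _ => ?_
    refine MvPolynomial.IsWeightedHomogeneous.sum _ _ _ fun b _ => ?_
    beta_reduce
    split_ifs
    · exact (h 0 a).mul (isWeightedHomogeneous_list_prod_coeff w _ _ (fun l => h l.succ) b)
    · exact MvPolynomial.isWeightedHomogeneous_zero K w _

/-- If the coordinates of the layer `l` have weight `u l`, then the polynomials `kronPoly` are
homogeneous of weight `∑ l, r ^ (L - 1 - l) • u l`. -/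
theorem kronPoly_isWeightedHomogeneous_sum {K G M : Type*} [Field K] [Group G] [Finite G]
    [AddCommMonoid M] (r : ℕ) {L : ℕ} (u : Fin L → M) (k : Fin (r ^ (L - 1)) → G) :
    (kronPoly K G r L k).IsWeightedHomogeneous (fun x : Fin L × G => u x.1)
      (∑ l : Fin L, r ^ (L - 1 - (l : ℕ)) • u l) := by
  classical
  refine isWeightedHomogeneous_list_prod_coeff _ _ _ (fun l k => ?_) k
  have hx : ∀ x : Fin (r ^ (L - 1 - (l : ℕ))) → G,
      ((kronPow _ (genericFilters K G L l)).coeff x).IsWeightedHomogeneous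
        (fun x : Fin L × G => u x.1) (r ^ (L - 1 - (l : ℕ)) • u l) := by
    intro x
    have := MvPolynomial.IsWeightedHomogeneous.prod (w := fun x : Fin L × G => u x.1) Finset.univ
      (fun j => (MvPolynomial.X (l, x j) : MvPolynomial (Fin L × G) K)) (fun _ => u l)
      fun j _ => MvPolynomial.isWeightedHomogeneous_X K _ (l, x j)
    simpa [kronPow, genericFilters] using this
  change MvPolynomial.IsWeightedHomogeneous _
    ((Finsupp.mapDomain (diagHom G r l) (kronPow _ (genericFilters K G L l)).coeff) k) _
  rw [Finsupp.mapDomain, Finsupp.sum, Finsupp.finsetSum_apply]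
  refine MvPolynomial.IsWeightedHomogeneous.sum _ _ _ fun x _ => ?_
  rw [Finsupp.single_apply]
  split_ifs
  · exact hx x
  · exact MvPolynomial.isWeightedHomogeneous_zero K _ _

/-- Euler's relation, with the degrees made explicit. -/
theorem jacobian_smul_self {K G : Type*} [Field K] [Group G] [Fintype G] (r : ℕ) {L : ℕ}
    (θ : Fin L → MonoidAlgebra K G) (c : Fin L → K) :
    jacobian r θ (fun l => c l • θ l)
      = (∑ l : Fin L, c l * (r : K) ^ (L - 1 - (l : ℕ))) • kronParam r θ := by
  classical
  ext k
  have eul : ∀ i : Fin L, ∑ g : G, (θ i).coeff g *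
      MvPolynomial.eval (coords θ) (MvPolynomial.pderiv (i, g) (kronPoly K G r L k))
      = (r : K) ^ (L - 1 - (i : ℕ)) * (kronParam r θ).coeff k := by
    intro i
    have h := congrArg (MvPolynomial.eval (coords θ))
      (kronPoly_isWeightedHomogeneous_sum (K := K) r (Pi.single i 1 : Fin L → ℕ)
        k).sum_weight_X_mul_pderiv
    rw [map_sum, Fintype.sum_prod_type, Finset.sum_eq_single i] at h
    · simpa [coords, eval_kronPoly, Pi.single_apply] using h
    · intro j _ hj
      simp [hj]
    · simp
  simp only [jacobian, LinearMap.coe_mk, AddHom.coe_mk, MonoidAlgebra.coeff_smul_apply,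
    Finsupp.equivFunOnFinite_symm_apply_apply, smul_eq_mul]
  rw [Fintype.sum_prod_type, Finset.sum_mul]
  refine Finset.sum_congr rfl fun l _ => ?_
  rw [mul_assoc, ← eul l, Finset.mul_sum]
  refine Finset.sum_congr rfl fun g _ => ?_
  simp [coords]
  ring

theorem rescalingDir_eq_smul {K G : Type*} [Field K] (r : ℕ) {L : ℕ}
    (θ : Fin L → MonoidAlgebra K G) (i : Fin (L - 1)) :
    rescalingDir r θ i = fun l : Fin L =>
      (if (l : ℕ) = i then 1 else if (l : ℕ) = i + 1 then -(r : K) else 0) • θ l := by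
  funext l
  unfold rescalingDir
  split_ifs <;> simp

/-- Consecutive layers have degrees in ratio `r`, so the two Euler terms cancel. -/
theorem jacobian_rescalingDir {K G : Type*} [Field K] [Group G] [Fintype G] (r : ℕ) {L : ℕ}
    (θ : Fin L → MonoidAlgebra K G) (i : Fin (L - 1)) :
    jacobian r θ (rescalingDir r θ i) = 0 := by
  have hi := i.isLt
  rw [rescalingDir_eq_smul, jacobian_smul_self]
  convert zero_smul K _
  rw [Finset.sum_eq_add (⟨i, by omega⟩ : Fin L) ⟨i + 1, by omega⟩]
  · have : L - 1 - (i : ℕ) = L - 1 - (i + 1) + 1 := by omega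
    simp [this, pow_succ']
  · simp
  · rintro l - ⟨h1, h2⟩
    rw [if_neg fun h => h1 (Fin.ext h), if_neg fun h => h2 (Fin.ext h), zero_mul]
  · simp
  · simp

theorem rescalingDir_linearIndependent {K G : Type*} [Field K] (r : ℕ) {L : ℕ}
    (θ : Fin L → MonoidAlgebra K G) (hθ : ∀ l, θ l ≠ 0) :
    LinearIndependent K (rescalingDir r θ) := by
  rw [Fintype.linearIndependent_iff]
  intro a ha
  -- The directions form a staircase: layer `i` meets only directions `i` and `i - 1`, and the
  -- coefficient of the latter is already known to vanish.
  suffices ∀ (n : ℕ) (i : Fin (L - 1)), (i : ℕ) = n → a i = 0 from fun i => this _ i rfl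
  intro n
  induction n using Nat.strong_induction_on with
  | _ n ih =>
    rintro i rfl
    have hi := i.isLt
    have h := congrFun ha ⟨i, by omega⟩
    rw [Finset.sum_apply, Finset.sum_eq_single i] at h
    · simpa [rescalingDir, hθ] using h
    · intro j _ hj
      rcases lt_or_ge (j : ℕ) i with hji | hji
      · simp [ih j hji j rfl]
      · have h1 : (i : ℕ) ≠ j := fun h => hj (Fin.ext h.symm)
        have h2 : (i : ℕ) ≠ j + 1 := by omega
        simp [rescalingDir, h1, h2]
    · simp

theorem ne_zero_of_kronParam_ne_zero {K G : Type*} [Field K] [Group G] [Finite G] {r : ℕ}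
    (hr : 0 < r) {L : ℕ} {θ : Fin L → MonoidAlgebra K G} (h : kronParam r θ ≠ 0) (l : Fin L) :
    θ l ≠ 0 := by
  intro hl
  refine h (List.prod_eq_zero ((List.mem_ofFn' _ _).2 ⟨l, ?_⟩))
  have : kronPow (r ^ (L - 1 - (l : ℕ))) (θ l) = 0 := by
    -- On an empty index set the Kronecker power of `0` would be `1`; positivity of `r` excludes
    -- this.
    have : Nonempty (Fin (r ^ (L - 1 - (l : ℕ)))) := ⟨⟨0, by positivity⟩⟩
    ext g
    simp [kronPow, hl, hr.ne']
  rw [layerFactor, this, map_zero]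

/-! ### The derivative at the identity filters -/

/-- First-order Taylor expansion of a polynomial over the dual numbers. -/
theorem aeval_inl_add_inr {K σ : Type*} [Field K] [Fintype σ] (a b : σ → K)
    (P : MvPolynomial σ K) :
    MvPolynomial.aeval (fun x => (TrivSqZeroExt.inl (a x) + TrivSqZeroExt.inr (b x) : DualNumber K))
        P
      = TrivSqZeroExt.inl (MvPolynomial.eval a P)
        + TrivSqZeroExt.inr
          (∑ x, MvPolynomial.eval a (MvPolynomial.pderiv x P) * b x) := by
  classical
  induction P using MvPolynomial.induction_on with
  | C c => simp; rfl
  | add p q hp hq =>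
    rw [map_add, hp, hq]
    ext <;> simp [add_mul, Finset.sum_add_distrib]
  | mul_X p i hp =>
    rw [map_mul, hp, MvPolynomial.aeval_X]
    ext
    · simp
    · have h : ∀ x, MvPolynomial.eval a (MvPolynomial.pderiv x (p * MvPolynomial.X i)) * b x
          = a i * (MvPolynomial.eval a (MvPolynomial.pderiv x p) * b x)
            + if i = x then MvPolynomial.eval a p * b i else 0 := by
        intro x
        by_cases hx : i = x
        · subst hx
          simp
          ring
        · simp [hx]
          ring
      simp only [h, Finset.sum_add_distrib, ← Finset.mul_sum]
      simp
      ring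

theorem prod_add_mul_of_sq_eq_zero {S ι : Type*} [CommRing S] [DecidableEq ι] (s : Finset ι)
    (a b : ι → S) (ε : S) (hε : ε * ε = 0) :
    ∏ i ∈ s, (a i + ε * b i) = ∏ i ∈ s, a i + ε * ∑ i ∈ s, b i * ∏ j ∈ s.erase i, a j := by
  induction s using Finset.induction_on with
  | empty => simp
  | insert i s hi ih =>
    have : ∑ j ∈ s, b j * ∏ k ∈ (insert i s).erase j, a k
        = a i * ∑ j ∈ s, b j * ∏ k ∈ s.erase j, a k := by
      rw [Finset.mul_sum]
      refine Finset.sum_congr rfl fun j hj => ?_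
      have hij : i ≠ j := fun h => hi (h ▸ hj)
      rw [Finset.erase_insert_of_ne hij, Finset.prod_insert (by simp [hi])]
      ring
    rw [Finset.prod_insert hi, Finset.prod_insert hi, Finset.sum_insert hi, ih, this,
      Finset.erase_insert hi]
    linear_combination (b i * ∑ j ∈ s, b j * ∏ k ∈ s.erase j, a k) * hε

/-- To first order in `ε`, at most one factor of the product deviates from the identity filter. -/
theorem kronPow_one_add_single {S G : Type*} [CommRing S] [Group G] [Finite G] (m : ℕ) (g : G)
    (ε : S) (hε : ε * ε = 0) :
    kronPow m (1 + MonoidAlgebra.single g ε)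
      = 1 + ∑ i : Fin m, MonoidAlgebra.single (Pi.mulSingle i g : Fin m → G) ε := by
  classical
  ext x
  have h := prod_add_mul_of_sq_eq_zero Finset.univ (fun i => if 1 = x i then (1 : S) else 0)
    (fun i => if g = x i then 1 else 0) ε hε
  have h1 : ∏ i, (if 1 = x i then (1 : S) else 0) = if 1 = x then 1 else 0 := by
    rw [Finset.prod_ite_zero]
    simp [funext_iff]
  have h2 : ∀ i, (if g = x i then (1 : S) else 0)
      * ∏ j ∈ Finset.univ.erase i, (if 1 = x j then (1 : S) else 0)
      = if Pi.mulSingle i g = x then 1 else 0 := by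
    intro i
    rw [Finset.prod_ite_zero, ite_zero_mul_ite_zero]
    simp only [Finset.prod_const_one, mul_one]
    refine if_congr ⟨fun ⟨h, h'⟩ => ?_, ?_⟩ rfl rfl
    · funext j
      by_cases hj : j = i
      · subst hj
        simpa using h
      · simpa [Pi.mulSingle_eq_of_ne hj] using h' j (by simp [hj])
    · rintro rfl
      exact ⟨by simp, fun j hj => by simp [Pi.mulSingle_eq_of_ne (Finset.ne_of_mem_erase hj)]⟩
  simp only [h1, h2, Finset.mul_sum] at h
  simpa [kronPow, MonoidAlgebra.one_def, Finsupp.single_apply] using h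

theorem kronPow_one {S G : Type*} [CommRing S] [Group G] [Finite G] (m : ℕ) :
    kronPow m (1 : MonoidAlgebra S G) = 1 := by
  have := kronPow_one_add_single m (1 : G) (0 : S) (by simp)
  simpa using this

theorem layerFactor_one {S G : Type*} [CommRing S] [Group G] [Finite G] (r : ℕ) {L : ℕ}
    (θ : Fin L → MonoidAlgebra S G) (l : Fin L) (h : θ l = 1) : layerFactor r θ l = 1 := by
  rw [layerFactor, h, kronPow_one, map_one]

theorem kronParam_one {S G : Type*} [CommRing S] [Group G] [Finite G] (r L : ℕ) :
    kronParam r (1 : Fin L → MonoidAlgebra S G) = 1 := by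
  rw [kronParam, List.prod_eq_one]
  intro a ha
  obtain ⟨l, rfl⟩ := (List.mem_ofFn' _ _).1 ha
  exact layerFactor_one r _ l rfl

theorem prod_ofFn_eq_single {A : Type*} [Monoid A] : ∀ {L : ℕ} (x : Fin L → A) (l : Fin L),
    (∀ i, i ≠ l → x i = 1) → (List.ofFn x).prod = x l
  | 0, _, l, _ => l.elim0
  | L + 1, x, l, h => by
    rw [List.ofFn_succ, List.prod_cons]
    refine Fin.cases (fun h => ?_) (fun l h => ?_) l h
    · rw [List.prod_eq_one, mul_one]
      intro a ha
      obtain ⟨i, rfl⟩ := (List.mem_ofFn' _ _).1 ha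
      exact h _ (Fin.succ_ne_zero i)
    · rw [h 0 (Fin.succ_ne_zero l).symm, one_mul]
      exact prod_ofFn_eq_single (fun i => x i.succ) l fun i hi => h _ (by simpa using hi)

open Classical in
/-- The partial derivatives of `φ` at the tuple of identity filters. -/
theorem eval_pderiv_kronPoly_one {K G : Type*} [Field K] [Group G] [Fintype G] (r L : ℕ)
    (l : Fin L) (g : G) (k : Fin (r ^ (L - 1)) → G) :
    MvPolynomial.eval (coords (1 : Fin L → MonoidAlgebra K G))
        (MvPolynomial.pderiv (l, g) (kronPoly K G r L k))
      = ∑ i : Fin (r ^ (L - 1 - (l : ℕ))),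
        if diagHom G r l (Pi.mulSingle i g) = k then 1 else 0 := by
  -- The homomorphism `f` evaluates at `1 + ε b` over the dual numbers, so the wanted derivative is
  -- the `ε`-part of `f (kronPoly K G r L k)`. The same element is computed by moving `f` inside
  -- `kronParam`, where only layer `l` differs from `1`.
  let b : Fin L × G → K := Pi.single (l, g) 1
  let f := (MvPolynomial.aeval (R := K) (fun x => (TrivSqZeroExt.inl (coords 1 x)
    + TrivSqZeroExt.inr (b x) : DualNumber K))).toRingHom
  have h1 : f (kronPoly K G r L k) = _ := aeval_inl_add_inr (coords 1) b _
  have h2 : f (kronPoly K G r L k) = (MonoidAlgebra.mapRingHom _ f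
      (kronParam r (genericFilters K G L))).coeff k := by
    rw [MonoidAlgebra.coeff_mapRingHom]
    rfl
  rw [map_kronParam] at h2
  have h3 : ∀ i, i ≠ l → MonoidAlgebra.mapRingHom _ f (genericFilters K G L i) = 1 := by
    intro i hi
    ext x
    · simp [f, genericFilters, coords, b, hi, MonoidAlgebra.one_def, Finsupp.single_apply]
      split_ifs <;> simp
    · simp [f, genericFilters, coords, b, hi, MonoidAlgebra.one_def, Finsupp.single_apply]
      split_ifs <;> simp
  have h4 : MonoidAlgebra.mapRingHom _ f (genericFilters K G L l)
      = 1 + MonoidAlgebra.single g DualNumber.eps := by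
    ext x
    · simp [f, genericFilters, coords, b, MonoidAlgebra.one_def, Finsupp.single_apply]
      split_ifs <;> simp
    · by_cases hx : g = x <;>
        simp [f, genericFilters, coords, b, MonoidAlgebra.one_def, Finsupp.single_apply,
          Pi.single_apply, hx] <;>
      split_ifs <;> simp_all
  rw [kronParam, prod_ofFn_eq_single _ l fun i hi => layerFactor_one r _ i (h3 i hi), layerFactor,
    h4, kronPow_one_add_single _ _ _ DualNumber.eps_mul_eps, map_add, map_one, map_sum, h1] at h2
  have h5 := congrArg TrivSqZeroExt.snd h2
  have h6 : TrivSqZeroExt.snd ((1 : MonoidAlgebra (DualNumber K)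
      (Fin (r ^ (L - 1)) → G)).coeff k) = 0 := by
    rw [MonoidAlgebra.one_def, MonoidAlgebra.coeff_single, Finsupp.single_apply]
    split_ifs <;> simp
  simpa [b, h6, Pi.single_apply, Finsupp.single_apply, TrivSqZeroExt.snd_sum,
    apply_ite TrivSqZeroExt.snd] using h5

/-! ### A minor of the Jacobian that is nonzero at the identity filters -/

/-- Indices of the rows and columns of a maximal nonvanishing minor of the Jacobian. -/
abbrev MinorIndex (G : Type*) [Group G] (L : ℕ) := Option (Fin L × {g : G // g ≠ 1})

theorem card_minorIndex (G : Type*) [Group G] [Fintype G] [DecidableEq G] (L : ℕ) :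
    Fintype.card (MinorIndex G L) = L * (Fintype.card G - 1) + 1 := by
  simp [MinorIndex, Fintype.card_subtype_compl]

/-- The coordinate of the filters that indexes a column of the minor. -/
def minorCol {G : Type*} [Group G] {L : ℕ} (last : Fin L) : MinorIndex G L → Fin L × G
  | none => (last, 1)
  | some (l, g) => (l, g)

/-- The coordinate of the output that indexes a row of the minor: `g` repeated on the first block
of length `r ^ l`, and `1` elsewhere. -/
def minorRow {G : Type*} [Group G] (r L : ℕ) : MinorIndex G L → Fin (r ^ (L - 1)) → G
  | none => 1
  | some (l, g) => fun j => if (j : ℕ) < r ^ (l : ℕ) then g else 1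

theorem diagHom_mulSingle_apply {G : Type*} [Group G] (r : ℕ) {L : ℕ} (l : Fin L)
    (i : Fin (r ^ (L - 1 - (l : ℕ)))) (g : G) (j : Fin (r ^ (L - 1))) :
    diagHom G r l (Pi.mulSingle i g) j = if (j : ℕ) / r ^ (l : ℕ) = i then g else 1 := by
  simp [diagHom, Pi.mulSingle_apply, Fin.ext_iff]

theorem diagHom_mulSingle_ne_one {G : Type*} [Group G] {r : ℕ} (hr : 2 ≤ r) {L : ℕ} (l : Fin L)
    (i : Fin (r ^ (L - 1 - (l : ℕ)))) {g : G} (hg : g ≠ 1) :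
    diagHom G r l (Pi.mulSingle i g) ≠ 1 := by
  have hp : 0 < r ^ (l : ℕ) := by positivity
  have hlt : (i : ℕ) * r ^ (l : ℕ) < r ^ (L - 1) := by
    have : r ^ (L - 1) = r ^ (L - 1 - (l : ℕ)) * r ^ (l : ℕ) := by
      rw [← pow_add, Nat.sub_add_cancel (by have := l.isLt; omega)]
    rw [this]
    exact Nat.mul_lt_mul_of_pos_right i.isLt hp
  intro h
  have := congrFun h ⟨_, hlt⟩
  rw [diagHom_mulSingle_apply, if_pos (Nat.mul_div_cancel _ hp)] at this
  exact hg this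

/-- Position `0` forces the block to be the first and the group elements to agree. If the layers
differed, the first position after the shorter block would separate the two tuples, as `r ≥ 2` makes
the lengths distinct. -/
theorem diagHom_mulSingle_eq_minorRow_iff {G : Type*} [Group G] {r : ℕ} (hr : 2 ≤ r) {L : ℕ}
    (l l' : Fin L) (i : Fin (r ^ (L - 1 - (l : ℕ)))) (g g' : {g : G // g ≠ 1}) :
    diagHom G r l (Pi.mulSingle i (g : G)) = minorRow r L (some (l', g'))
      ↔ l = l' ∧ (i : ℕ) = 0 ∧ g = g' := by
  have hp : ∀ n, 0 < r ^ n := fun n => by positivity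
  constructor
  · intro h
    have hj : ∀ j : Fin (r ^ (L - 1)), (if (j : ℕ) / r ^ (l : ℕ) = i then (g : G) else 1)
        = if (j : ℕ) < r ^ (l' : ℕ) then (g' : G) else 1 := fun j => by
      rw [← diagHom_mulSingle_apply, h]
      rfl
    have h0 := hj ⟨0, hp _⟩
    have hi : (i : ℕ) = 0 := by
      by_contra hi
      rw [if_neg (by simpa using Ne.symm hi), if_pos (hp _)] at h0
      exact g'.2 h0.symm
    rw [if_pos (by simp [hi]), if_pos (hp _)] at h0
    refine ⟨?_, hi, Subtype.ext h0⟩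
    rcases lt_trichotomy (l : ℕ) l' with hl | hl | hl
    · have h1 := hj ⟨r ^ (l : ℕ), Nat.pow_lt_pow_right hr (by omega)⟩
      rw [if_neg (by simp [hi, Nat.div_self (hp _)]), if_pos (Nat.pow_lt_pow_right hr hl)] at h1
      exact absurd h1.symm g'.2
    · exact Fin.ext hl
    · have h1 := hj ⟨r ^ (l' : ℕ), Nat.pow_lt_pow_right hr (by omega)⟩
      rw [if_pos (by rw [hi]; exact Nat.div_eq_of_lt (Nat.pow_lt_pow_right hr hl)),
        if_neg (lt_irrefl _)] at h1
      exact absurd h1 g.2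
  · rintro ⟨rfl, hi, rfl⟩
    funext j
    rw [diagHom_mulSingle_apply, hi]
    simp [minorRow, Nat.div_eq_zero_iff, show r ≠ 0 by omega]

/-- A square submatrix of the matrix of partial derivatives of `φ`. -/
def minorMatrix (K G : Type*) [Field K] [Group G] [Finite G] (r : ℕ) {L : ℕ} (last : Fin L) :
    Matrix (MinorIndex G L) (MinorIndex G L) (MvPolynomial (Fin L × G) K) :=
  Matrix.of fun t s => MvPolynomial.pderiv (minorCol last s) (kronPoly K G r L (minorRow r L t))

open Classical in
theorem eval_minorMatrix_one (K G : Type*) [Field K] [Group G] [Fintype G] {r : ℕ} (hr : 2 ≤ r)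
    {L : ℕ} (last : Fin L) (hlast : (last : ℕ) = L - 1) :
    (minorMatrix K G r last).map (MvPolynomial.eval (coords (1 : Fin L → MonoidAlgebra K G)))
      = 1 := by
  ext t s
  rw [Matrix.map_apply, minorMatrix, Matrix.of_apply]
  rcases s with _ | ⟨l, g⟩
  · rw [minorCol, eval_pderiv_kronPoly_one]
    simp only [Pi.mulSingle_one, map_one]
    rcases t with _ | ⟨l', g'⟩
    -- The last layer has only `r^0 = 1` block, hence the entry `1`; an earlier layer would give a
    -- power of `r`.
    · simp [minorRow, hlast]
    · have : (1 : Fin (r ^ (L - 1)) → G) ≠ minorRow r L (some (l', g')) := by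
        intro h
        have := congrFun h ⟨0, by positivity⟩
        exact g'.2 (by simpa [minorRow, show 0 < r by omega] using this.symm)
      simp [this]
  · rw [minorCol, eval_pderiv_kronPoly_one]
    rcases t with _ | ⟨l', g'⟩
    · simp [minorRow, diagHom_mulSingle_ne_one hr l _ g.2]
    · simp only [diagHom_mulSingle_eq_minorRow_iff hr]
      by_cases h : l = l' ∧ g = g'
      · obtain ⟨rfl, rfl⟩ := h
        rw [Finset.sum_eq_single (⟨0, by positivity⟩ : Fin (r ^ (L - 1 - (l : ℕ))))]
        · simp
        · intro i _ hi
          simp [Fin.ext_iff] at hi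
          simp [hi]
        · simp
      · rw [Matrix.one_apply_ne]
        · refine Finset.sum_eq_zero fun i _ => if_neg ?_
          rintro ⟨h1, -, h2⟩
          exact h ⟨h1, h2⟩
        · rintro h'
          simp only [Option.some.injEq, Prod.mk.injEq] at h'
          exact h ⟨h'.1.symm, h'.2.symm⟩

open Classical in
/-- The determinant of `minorMatrix`. -/
def minorDet (K G : Type*) [Field K] [Group G] [Fintype G] (r : ℕ) {L : ℕ} (last : Fin L) :
    MvPolynomial (Fin L × G) K :=
  (minorMatrix K G r last).det

theorem eval_minorDet_one (K G : Type*) [Field K] [Group G] [Fintype G] {r : ℕ} (hr : 2 ≤ r)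
    {L : ℕ} (last : Fin L) (hlast : (last : ℕ) = L - 1) :
    MvPolynomial.eval (coords (1 : Fin L → MonoidAlgebra K G)) (minorDet K G r last) = 1 := by
  classical
  rw [minorDet, RingHom.map_det, RingHom.mapMatrix_apply, eval_minorMatrix_one K G hr last hlast,
    Matrix.det_one]

/-- Each term of the Leibniz expansion takes one entry from every column, and the weight depends on
the column only. -/
theorem det_isWeightedHomogeneous {K σ M ι : Type*} [Field K] [AddCommMonoid M] [Fintype ι]
    [DecidableEq ι] (w : σ → M) (A : Matrix ι ι (MvPolynomial σ K)) (d : ι → M)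
    (h : ∀ i j, (A i j).IsWeightedHomogeneous w (d j)) :
    A.det.IsWeightedHomogeneous w (∑ j, d j) := by
  rw [Matrix.det_apply]
  refine MvPolynomial.IsWeightedHomogeneous.sum _ _ _ fun p _ => ?_
  have := MvPolynomial.IsWeightedHomogeneous.prod (w := w) Finset.univ (fun i => A (p i) i) d
    fun i _ => h _ _
  rcases Int.units_eq_one_or (Equiv.Perm.sign p) with hp | hp
  · simpa [hp] using this
  · simpa [hp] using this.neg

theorem minorDet_isWeightedHomogeneous (K G : Type*) [Field K] [Group G] [Fintype G] {r : ℕ}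
    (hr : 2 ≤ r) {L : ℕ} (last : Fin L) :
    ∃ d : Fin L → ℕ, (minorDet K G r last).IsWeightedHomogeneous
      (fun x : Fin L × G => (Pi.single x.1 1 : Fin L → ℕ)) d := by
  classical
  let e : Fin L → ℕ := ∑ l : Fin L, r ^ (L - 1 - (l : ℕ)) • Pi.single l 1
  -- Needed because the subtraction in the column degrees below is truncated.
  have he : ∀ l, 1 ≤ e l := by
    intro l
    have : 0 < r ^ (L - 1 - (l : ℕ)) := by positivity
    simpa [e, Finset.sum_apply, Pi.single_apply, Nat.one_le_iff_ne_zero,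
      Nat.pos_iff_ne_zero] using this
  refine ⟨_, det_isWeightedHomogeneous _ _
    (fun s => e - Pi.single (minorCol last s).1 1) fun t s => ?_⟩
  refine (kronPoly_isWeightedHomogeneous_sum r (fun l : Fin L => (Pi.single l 1 : Fin L → ℕ))
    (minorRow r L t)).pderiv (tsub_add_cancel_of_le ?_)
  intro l
  by_cases hl : l = (minorCol last s).1
  · simpa [hl] using he _
  · simp [hl]

/-! ### The kernel of the Jacobian -/

theorem finrank_filters (K G : Type*) [Field K] [Fintype G] (L : ℕ) :
    Module.finrank K (Fin L → MonoidAlgebra K G) = L * Fintype.card G := by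
  have : Module.finrank K (MonoidAlgebra K G) = Fintype.card G := by
    rw [(MonoidAlgebra.coeffLinearEquiv K).finrank_eq, Module.finrank_finsupp_self]
  simp [Module.finrank_pi_fintype, this]

instance (K G : Type*) [Field K] [Finite G] : Module.Finite K (MonoidAlgebra K G) :=
  Module.Finite.equiv (MonoidAlgebra.coeffLinearEquiv K).symm

theorem finrank_ker_jacobian_le {K G : Type*} [Field K] [Group G] [Fintype G] {r L : ℕ}
    (last : Fin L) {θ : Fin L → MonoidAlgebra K G}
    (hθ : MvPolynomial.eval (coords θ) (minorDet K G r last) ≠ 0) :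
    Module.finrank K (LinearMap.ker (jacobian r θ)) ≤ L - 1 := by
  classical
  -- The Jacobian followed by projection to the rows of the minor. It is surjective, its kernel
  -- contains that of the Jacobian, and rank-nullity gives the bound.
  let p : (Fin L → MonoidAlgebra K G) →ₗ[K] (MinorIndex G L → K) :=
    { toFun := fun v t => (jacobian r θ v).coeff (minorRow r L t)
      map_add' := fun v w => by ext; simp
      map_smul' := fun c v => by ext; simp }
  have hp : Function.Surjective p := by
    intro w
    have hM : IsUnit ((minorMatrix K G r last).map (MvPolynomial.eval (coords θ))) := by
      rw [Matrix.isUnit_iff_isUnit_det, isUnit_iff_ne_zero]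
      rwa [minorDet, RingHom.map_det] at hθ
    obtain ⟨u, hu⟩ := Matrix.mulVec_surjective_iff_isUnit.2 hM w
    have hc : Function.Injective (minorCol last : MinorIndex G L → Fin L × G) := by
      rintro (_ | ⟨l, g⟩) (_ | ⟨l', g'⟩) h
      · rfl
      · simp only [minorCol, Prod.mk.injEq] at h
        exact absurd h.2.symm g'.2
      · simp only [minorCol, Prod.mk.injEq] at h
        exact absurd h.2 g.2
      · simp only [minorCol, Prod.mk.injEq] at h
        rw [h.1, Subtype.ext h.2]
    -- A solution of the square system, extended by zero to the coordinates outside the minor.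
    let v : Fin L → MonoidAlgebra K G := fun l => MonoidAlgebra.ofCoeff
      (Finsupp.equivFunOnFinite.symm fun g => Function.extend (minorCol last) u 0 (l, g))
    have hv : ∀ x, coords v x = Function.extend (minorCol last) u 0 x := fun x => rfl
    refine ⟨v, ?_⟩
    rw [← hu]
    funext t
    change ∑ x : Fin L × G, _ * coords v x = ∑ s, _
    simp only [hv]
    symm
    refine Finset.sum_of_injOn (minorCol last) hc.injOn (by simp) ?_ ?_
    · intro x _ hx
      rw [Function.extend_apply' _ _ _ (by simpa using hx), Pi.zero_apply, mul_zero]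
    · intro s _
      rw [hc.extend_apply]
      rfl
  have h1 : LinearMap.ker (jacobian r θ) ≤ LinearMap.ker p := by
    intro v hv
    rw [LinearMap.mem_ker] at hv ⊢
    funext t
    change (jacobian r θ v).coeff _ = _
    simp [hv]
  have h2 := LinearMap.finrank_range_add_finrank_ker p
  rw [LinearMap.range_eq_top.2 hp, finrank_top, Module.finrank_fintype_fun_eq_card,
    finrank_filters, card_minorIndex] at h2
  have h3 := Submodule.finrank_mono h1
  have hG : 0 < Fintype.card G := Fintype.card_pos
  have h4 : L * Fintype.card G = L * (Fintype.card G - 1) + L := by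
    obtain ⟨n, hn⟩ := Nat.exists_eq_succ_of_ne_zero hG.ne'
    rw [hn]
    simp [Nat.mul_succ]
  have := last.isLt
  omega

theorem ker_jacobian_eq_span {K G : Type*} [Field K] [Group G] [Fintype G] {r L : ℕ}
    (last : Fin L) {θ : Fin L → MonoidAlgebra K G}
    (hθ : MvPolynomial.eval (coords θ) (minorDet K G r last) ≠ 0) (hθ0 : ∀ l, θ l ≠ 0) :
    LinearMap.ker (jacobian r θ) = Submodule.span K (Set.range (rescalingDir r θ)) := by
  symm
  apply Submodule.eq_of_le_of_finrank_le
  · rw [Submodule.span_le]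
    rintro _ ⟨i, rfl⟩
    exact jacobian_rescalingDir r θ i
  · rw [finrank_span_eq_card (rescalingDir_linearIndependent r θ hθ0), Fintype.card_fin]
    exact finrank_ker_jacobian_le last hθ

theorem projDifferential_injective {K G : Type*} [Field K] [Group G] [Fintype G] {r L : ℕ}
    (last : Fin L) (hlast : (last : ℕ) = L - 1) {θ : Fin L → MonoidAlgebra K G}
    (hθ : MvPolynomial.eval (coords θ) (minorDet K G r last) ≠ 0) (hθ0 : ∀ l, θ l ≠ 0) :
    Function.Injective (projDifferential r θ) := by
  classical
  rw [projDifferential, LinearMap.coe_comp]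
  refine Function.Injective.comp ?_ (LinearEquiv.injective _)
  rw [← LinearMap.ker_eq_bot, Submodule.ker_mapQ, eq_bot_iff, Submodule.map_le_iff_le_comap,
    Submodule.comap_bot, Submodule.ker_mkQ]
  intro v hv
  rw [Submodule.mem_comap, Submodule.mem_span_singleton] at hv
  obtain ⟨a, ha⟩ := hv
  -- The last layer has degree `1`, so by Euler's relation `a θ_L` in that layer maps exactly to `a
  -- φ_θ`. Subtracting it moves `v` into the kernel, which lies in the product of the lines `K θ_l`.
  let c : Fin L → K := Pi.single last a
  have h1 : v - (fun l => c l • θ l) ∈ LinearMap.ker (jacobian r θ) := by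
    rw [LinearMap.mem_ker, map_sub, jacobian_smul_self, ← ha, sub_eq_zero]
    congr 1
    rw [Finset.sum_eq_single last]
    · simp [c, hlast]
    · intro l _ hl
      simp [c, hl]
    · simp
  have h2 : ∀ c : Fin L → K, (fun l => c l • θ l) ∈
      Submodule.pi Set.univ (fun l => Submodule.span K {θ l}) := fun c l _ =>
    Submodule.smul_mem _ _ (Submodule.mem_span_singleton_self _)
  have h3 : LinearMap.ker (jacobian r θ) ≤
      Submodule.pi Set.univ (fun l => Submodule.span K {θ l}) := by
    rw [ker_jacobian_eq_span last hθ hθ0, Submodule.span_le]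
    rintro _ ⟨i, rfl⟩
    rw [rescalingDir_eq_smul]
    exact h2 _
  simpa using add_mem (h3 h1) (h2 c)

theorem hasFullRank_of_injective {K V W : Type*} [Field K] [AddCommGroup V] [Module K V]
    [AddCommGroup W] [Module K W] [Module.Finite K W] {f : V →ₗ[K] W}
    (hf : Function.Injective f) : HasFullRank f := by
  rw [HasFullRank, LinearMap.finrank_range_of_inj hf,
    min_eq_left (LinearMap.finrank_le_finrank_of_injective hf)]

/-! ### The dimension of the image -/

/-- The substitution that sets to `1` the coordinates of index `1` of all layers but `last`. -/
def normalization (K : Type*) {G : Type*} [Field K] [Group G] {L : ℕ} (last : Fin L)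
    (x : Fin L × G) : MvPolynomial (MinorIndex G L) K :=
  open Classical in
  if h : x.2 = 1 then (if x.1 = last then MvPolynomial.X none else 1)
  else MvPolynomial.X (some (x.1, ⟨x.2, h⟩))

/-- All layers but the last are divided by their coefficient at `1`, and the last one absorbs the
resulting constant. As its degree is `1`, no roots have to be extracted. -/
theorem exists_eval_normalization_eq {K G : Type*} [Field K] [Group G] [Finite G] {r L : ℕ}
    (last : Fin L) (hlast : (last : ℕ) = L - 1) (θ : Fin L → MonoidAlgebra K G)
    (hθ : ∀ l, (θ l).coeff 1 ≠ 0) :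
    ∃ y : MinorIndex G L → K, ∃ θ' : Fin L → MonoidAlgebra K G, kronParam r θ' = kronParam r θ ∧
      coords θ' = fun x => MvPolynomial.eval y (normalization K last x) := by
  classical
  let c : Fin L → K := Function.update (fun l => ((θ l).coeff 1)⁻¹) last
    (∏ l ∈ Finset.univ.erase last, (θ l).coeff 1 ^ r ^ (L - 1 - (l : ℕ)))
  let θ' : Fin L → MonoidAlgebra K G := fun l => c l • θ l
  refine ⟨fun t => coords θ' (minorCol last t), θ', ?_, ?_⟩
  · rw [kronParam_smul]
    convert one_smul K _
    rw [← Finset.mul_prod_erase _ _ (Finset.mem_univ last)]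
    simp only [c, Function.update_self, hlast, Nat.sub_self, pow_zero, pow_one]
    rw [← Finset.prod_mul_distrib]
    refine Finset.prod_eq_one fun l hl => ?_
    rw [Function.update_of_ne (Finset.ne_of_mem_erase hl), ← mul_pow, mul_inv_cancel₀ (hθ l),
      one_pow]
  · funext ⟨l, g⟩
    by_cases hg : g = 1
    · subst hg
      by_cases hl : l = last
      · subst hl
        simp [normalization, minorCol]
      · simp [normalization, hl, coords, θ', c, hθ]
    · simp [normalization, hg, minorCol]

theorem aeval_kronPoly {K G : Type*} [Field K] [Group G] [Finite G] (r : ℕ) {L : ℕ}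
    (θ : Fin L → MonoidAlgebra K G) (P : MvPolynomial (Fin (r ^ (L - 1)) → G) K) :
    MvPolynomial.eval (coords θ) (MvPolynomial.aeval (kronPoly K G r L) P)
      = MvPolynomial.aeval ((kronParam r θ).coeff : (Fin (r ^ (L - 1)) → G) → K) P := by
  have h := MvPolynomial.comp_aeval_apply (kronPoly K G r L)
    (MvPolynomial.aeval (R := K) (coords θ)) P
  simp only [MvPolynomial.aeval_eq_eval, eval_kronPoly] at h ⊢
  exact h

theorem coords_surjective {K G : Type*} [Field K] [Finite G] {L : ℕ} (x : Fin L × G → K) :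
    ∃ θ : Fin L → MonoidAlgebra K G, coords θ = x :=
  ⟨fun l => MonoidAlgebra.ofCoeff (Finsupp.equivFunOnFinite.symm fun g => x (l, g)), rfl⟩

theorem vanishingIdeal_kronImage (K G : Type*) [Field K] [Infinite K] [Group G] [Finite G]
    (r L : ℕ) :
    MvPolynomial.vanishingIdeal K
        ((fun ψ : MonoidAlgebra K (Fin (r ^ (L - 1)) → G) => (ψ.coeff : _ → K)) ''
          kronImage K G r L)
      = RingHom.ker (MvPolynomial.aeval (R := K) (kronPoly K G r L)) := by
  ext P
  rw [MvPolynomial.mem_vanishingIdeal_iff, RingHom.mem_ker]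
  constructor
  · intro h
    refine MvPolynomial.funext fun x => ?_
    obtain ⟨θ, rfl⟩ := coords_surjective x
    rw [aeval_kronPoly, map_zero]
    exact h _ ⟨_, ⟨θ, rfl⟩, rfl⟩
  · rintro h _ ⟨_, ⟨θ, rfl⟩, rfl⟩
    rw [← aeval_kronPoly, h, map_zero]

/-- Normalized parameters reach every `φ_θ` whose filters have nonzero coefficient at `1`. Such `θ`
are dense because `K` is infinite, so no new relations appear. -/
theorem ker_aeval_normalization (K G : Type*) [Field K] [Infinite K] [Group G] [Finite G] (r : ℕ)
    {L : ℕ} (last : Fin L) (hlast : (last : ℕ) = L - 1) :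
    RingHom.ker (MvPolynomial.aeval (R := K) (kronPoly K G r L))
      = RingHom.ker (MvPolynomial.aeval (R := K) fun k =>
          MvPolynomial.aeval (normalization K last) (kronPoly K G r L k)) := by
  have key : ∀ P, MvPolynomial.aeval (R := K) (fun k =>
          MvPolynomial.aeval (normalization K last) (kronPoly K G r L k)) P
      = MvPolynomial.aeval (normalization K last)
          (MvPolynomial.aeval (R := K) (kronPoly K G r L) P) := by
    intro P
    exact (MvPolynomial.comp_aeval_apply _ _ P).symm
  ext P
  rw [RingHom.mem_ker, RingHom.mem_ker, key]
  refine ⟨fun h => by rw [h, map_zero], fun h => ?_⟩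
  -- It suffices to test points with all coordinates nonzero, a product of infinite sets.
  refine MvPolynomial.funext_set (fun _ => {0}ᶜ) (fun _ => (Set.finite_singleton 0).infinite_compl)
    fun x hx => ?_
  obtain ⟨θ, rfl⟩ := coords_surjective x
  obtain ⟨y, θ', h1, h2⟩ := exists_eval_normalization_eq (r := r) last hlast θ
    fun l => hx (l, 1) (Set.mem_univ _)
  rw [aeval_kronPoly, ← h1, ← aeval_kronPoly, h2, map_zero]
  have h3 := MvPolynomial.comp_aeval_apply (normalization K last)
    (MvPolynomial.aeval (R := K) y) (MvPolynomial.aeval (R := K) (kronPoly K G r L) P)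
  rw [h, map_zero] at h3
  simpa [MvPolynomial.aeval_eq_eval] using h3.symm

theorem zariskiDim_kronImage (K G : Type*) [Field K] [CharZero K] [Group G] [Fintype G] {r L : ℕ}
    (hr : 2 ≤ r) (hL : 1 ≤ L) :
    zariskiDim (kronImage K G r L) = ((L * (Fintype.card G - 1) + 1 : ℕ) : WithBot ℕ∞) := by
  classical
  let last : Fin L := ⟨L - 1, by omega⟩
  have hdet : minorDet K G r last ≠ 0 := by
    intro h
    have := eval_minorDet_one K G hr last rfl
    simp [h] at this
  rw [zariskiDim, ← card_minorIndex, vanishingIdeal_kronImage]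
  exact ringKrullDim_quotient_eq_card (kronPoly K G r L) (minorRow r L) (minorCol last)
    (by convert hdet using 1; simp only [minorDet, minorMatrix]) _ _ rfl
    (ker_aeval_normalization K G r last rfl)

end PGCNN

end

/-! ### Assembly of the three statements -/

theorem mainTheorem1 {K : Type*} [Field K] [CharZero K] {G : Type*} [Group G] [Fintype G]
    (r L : ℕ) (hr : 2 ≤ r) (hL : 1 ≤ L) :
    PGCNN.IsGeneralProj (fun p : Fin L → ℙ K (MonoidAlgebra K G) =>
      (PGCNN.kronProj r p).Dom ∧
      PGCNN.HasFullRank (PGCNN.projDifferential r fun l => (p l).rep) ∧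
      Function.Injective (PGCNN.projDifferential r fun l => (p l).rep)) ∧
    PGCNN.zariskiDim (PGCNN.kronImage K G r L) = ((L * (Fintype.card G - 1) + 1 : ℕ) : WithBot ℕ∞) ∧
    PGCNN.IsGeneral (fun θ : Fin L → MonoidAlgebra K G =>
      LinearIndependent K (PGCNN.rescalingDir r θ) ∧
      LinearMap.ker (PGCNN.jacobian r θ) =
        Submodule.span K (Set.range (PGCNN.rescalingDir r θ))) := by
  let last : Fin L := ⟨L - 1, by omega⟩
  -- The second factor, a coordinate of `φ`, ensures `φ_θ ≠ 0` and hence that every `θ_l` is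
  -- nonzero. Both factors equal `1` at the identity filters and are multihomogeneous, so one `F`
  -- serves both the affine and the projective statement.
  let F := PGCNN.minorDet K G r last * PGCNN.kronPoly K G r L 1
  have hF : F ≠ 0 := by
    intro h
    have h1 : MvPolynomial.eval (PGCNN.coords (1 : Fin L → MonoidAlgebra K G)) F = 1 := by
      rw [map_mul, PGCNN.eval_minorDet_one K G hr last rfl, PGCNN.eval_kronPoly,
        PGCNN.kronParam_one, MonoidAlgebra.coeff_one_one, one_mul]
    simp [h] at h1
  have hFθ : ∀ θ : Fin L → MonoidAlgebra K G, MvPolynomial.eval (PGCNN.coords θ) F ≠ 0 →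
      MvPolynomial.eval (PGCNN.coords θ) (PGCNN.minorDet K G r last) ≠ 0 ∧
        PGCNN.kronParam r θ ≠ 0 := by
    intro θ h
    rw [map_mul, PGCNN.eval_kronPoly] at h
    refine ⟨left_ne_zero_of_mul h, fun h0 => right_ne_zero_of_mul h ?_⟩
    simp [h0]
  refine ⟨?_, PGCNN.zariskiDim_kronImage K G hr hL, F, hF, fun θ hθ => ?_⟩
  · obtain ⟨d, hd⟩ := PGCNN.minorDet_isWeightedHomogeneous K G hr last
    refine ⟨F, _, hF, hd.mul (PGCNN.kronPoly_isWeightedHomogeneous_sum r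
      (fun l : Fin L => (Pi.single l 1 : Fin L → ℕ)) 1), fun p hp => ?_⟩
    obtain ⟨h1, h2⟩ := hFθ _ hp
    have h3 := PGCNN.projDifferential_injective last rfl h1 fun l => (p l).rep_nonzero
    exact ⟨h2, PGCNN.hasFullRank_of_injective h3, h3⟩
  · obtain ⟨h1, h2⟩ := hFθ θ hθ
    have h3 := PGCNN.ne_zero_of_kronParam_ne_zero (by omega) h2
    exact ⟨PGCNN.rescalingDir_linearIndependent r θ h3, PGCNN.ker_jacobian_eq_span last h1 h3⟩
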